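/- Let $n,m\ge 0$ be integers and let $F:\mathbb{R}^n\times\mathbb{R}^m\to\mathbb{R}^n$ be locally Lipschitz (every point has a neighbourhood on which $F$ is Lipschitz), where all norms are Euclidean. The Clarke generalized Jacobian $\partial F(x,y)$ is the convex hull of the set of all limits $\lim_{k\to\infty} F'(x_k,y_k)$, where $(x_k,y_k)\to(x,y)$, $F$ is differentiable at every $(x_k,y_k)$, and the limit exists. The partial generalized Jacobian $\partial_xF(x,y)$ is the set of all $n\times n$ matrices $M$ for which there is an $n\times m$ matrix $N$ with $[M,N]\in\partial F(x,y)$. Assume that (b1) for every $y\in\mathbb{R}^m$ the functional $\varphi_y(x)=\tfrac12\|F(x,y)\|^2$ on $\mathbb{R}^n$ is coercive, i.e. $\varphi_y(x)\to+\infty$ as $\|x\|\to\infty$; (b2) for all $(x,y)\in\mathbb{R}^n\times\mathbb{R}^m$ the set $\partial_xF(x,y)$ is of maximal rank, i.e. every matrix in it is nonsingular. Then there exists a unique locally Lipschitz function $f:\mathbb{R}^m\to\mathbb{R}^n$ such that for all $(x,y)\in\mathbb{R}^n\times\mathbb{R}^m$ one has $F(x,y)=0$ if and only if $x=f(y)$.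 -/

import Mathlib

open Filter Topology

/-- The Clarke generalized Jacobian of `f` at `x`: the convex hull of all limits of derivatives
`f' (u k)` along sequences `u k → x` of points at which `f` is differentiable. -/
def clarkeJacobian {E G : Type*} [NormedAddCommGroup E] [NormedSpace ℝ E]
    [NormedAddCommGroup G] [NormedSpace ℝ G] (f : E → G) (x : E) : Set (E →L[ℝ] G) :=
  convexHull ℝ {A | ∃ u : ℕ → E, (∀ k, DifferentiableAt ℝ f (u k)) ∧
    Tendsto u atTop (𝓝 x) ∧ Tendsto (fun k => fderiv ℝ f (u k)) atTop (𝓝 A)}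

/-- The partial Clarke generalized Jacobian with respect to the first variable: all blocks `M`
such that `[M, N]` lies in the generalized Jacobian of `F` at `(x, y)` for some `N`. -/
def partialClarkeJacobian {E H G : Type*} [NormedAddCommGroup E] [NormedSpace ℝ E]
    [NormedAddCommGroup H] [NormedSpace ℝ H] [NormedAddCommGroup G] [NormedSpace ℝ G]
    (F : E × H → G) (x : E) (y : H) : Set (E →L[ℝ] G) :=
  {M | ∃ N : H →L[ℝ] G, M.coprod N ∈ clarkeJacobian F (x, y)}

/-- A set of linear maps is of maximal rank if all its members are nonsingular. -/
def IsOfMaximalRank {E G : Type*} [NormedAddCommGroup E] [NormedSpace ℝ E]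
    [NormedAddCommGroup G] [NormedSpace ℝ G] (S : Set (E →L[ℝ] G)) : Prop :=
  ∀ M ∈ S, Function.Bijective M

/-- `φ x → +∞` as `‖x‖ → ∞`. -/
def IsCoerciveFunctional {E : Type*} [NormedAddCommGroup E] (φ : E → ℝ) : Prop :=
  Tendsto φ (comap (fun x : E => ‖x‖) atTop) atTop

/-! A small thickening of the Clarke Jacobian at a point is a compact convex set of linear maps
which, by a nonsmooth mean value theorem, contains the slopes of all nearby increments. If all its
members are nonsingular, compactness gives a lower Lipschitz bound; moreover a local minimum of the
distance from the values of the map to a target can only be a solution, because convexity provides a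
common descent direction. Hence the map is open, and therefore a local homeomorphism.

Applied to a slice `x ↦ F (x, y)`, which is proper by coercivity, this yields a covering of a simply
connected space, that is, a bijection (Hadamard), and so the implicit function. Applied to
`(x, y) ↦ (F (x, y), y)`, it yields the Lipschitz dependence on `y`. -/

open MeasureTheory in
theorem sub_mem_of_ae_deriv_mem {G : Type*} [NormedAddCommGroup G] [NormedSpace ℝ G] {h : ℝ → G}
    {K : NNReal} (hh : LipschitzOnWith K h (Set.Icc 0 1)) {C : Set G} (hC : Convex ℝ C)
    (hC' : IsClosed C)
    (hd : ∀ᵐ t, t ∈ Set.Icc (0 : ℝ) 1 → DifferentiableAt ℝ h t ∧ deriv h t ∈ C) :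
    h 1 - h 0 ∈ C := by
  by_contra hmem
  obtain ⟨l, u, hlt, hu⟩ := geometric_hahn_banach_point_closed hC hC' hmem
  have hac : AbsolutelyContinuousOnInterval (l ∘ h) 0 1 := by
    rw [← Set.uIcc_of_le zero_le_one] at hh
    exact (l.lipschitz.comp_lipschitzOnWith hh).absolutelyContinuousOnInterval
  have hderiv : ∀ᵐ t, t ∈ Set.Icc (0 : ℝ) 1 → u ≤ deriv (l ∘ h) t := hd.mono fun t ht htI => by
    rw [(l.hasFDerivAt.comp_hasDerivAt t (ht htI).1.hasDerivAt).deriv]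
    exact (hu _ (ht htI).2).le
  have hint : u ≤ l (h 1) - l (h 0) := calc
    u = ∫ _ in (0 : ℝ)..1, u := by simp
    _ ≤ ∫ t in (0 : ℝ)..1, deriv (l ∘ h) t :=
      intervalIntegral.integral_mono_ae_restrict zero_le_one intervalIntegrable_const
        hac.intervalIntegrable_deriv ((ae_restrict_iff' measurableSet_Icc).2 hderiv)
    _ = l (h 1) - l (h 0) := hac.integral_deriv_eq_sub
  rw [map_sub] at hlt
  exact hint.not_gt hlt

section Lipschitz

variable {X G : Type*} [NormedAddCommGroup X] [NormedSpace ℝ X] [NormedAddCommGroup G]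
  [NormedSpace ℝ G] {K : NNReal} {f : X → G} {S : Set X}

theorem sub_mem_of_ae_fderiv_segment_mem (hf : LipschitzOnWith K f S) {C : Set G}
    (hC : Convex ℝ C) (hC' : IsClosed C) {a v : X}
    (hS : ∀ t ∈ Set.Icc (0 : ℝ) 1, a + t • v ∈ S)
    (hd : ∀ᵐ t : ℝ, t ∈ Set.Icc (0 : ℝ) 1 →
      DifferentiableAt ℝ f (a + t • v) ∧ fderiv ℝ f (a + t • v) v ∈ C) :
    f (a + v) - f a ∈ C := by
  have hlip : LipschitzWith ‖v‖₊ fun t : ℝ => a + t • v := .of_dist_le_mul fun s t => by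
    rw [dist_add_left, dist_eq_norm, ← sub_smul, norm_smul, mul_comm, coe_nnnorm, Real.dist_eq,
      Real.norm_eq_abs]
  have hline := sub_mem_of_ae_deriv_mem (hf.comp hlip.lipschitzOnWith hS) hC hC'
    (hd.mono fun t ht htI => by
      have hdt : HasDerivAt (fun s : ℝ => a + s • v) v t := by
        simpa using ((hasDerivAt_id t).smul_const v).const_add a
      have hcomp := (ht htI).1.hasFDerivAt.comp_hasDerivAt t hdt
      exact ⟨hcomp.differentiableAt, hcomp.deriv ▸ (ht htI).2⟩)
  simpa using hline

variable [FiniteDimensional ℝ X] [FiniteDimensional ℝ G]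

open MeasureTheory in
theorem ae_ae_differentiableAt_add_smul [MeasurableSpace X] [BorelSpace X] (μ : Measure X)
    [μ.IsAddHaarMeasure] (hf : LipschitzOnWith K f S) (hS : IsOpen S) (v : X) :
    ∀ᵐ a ∂μ, ∀ᵐ t : ℝ, a + t • v ∈ S → DifferentiableAt ℝ f (a + t • v) := by
  have hmeas : MeasurableSet {z | z ∈ S → DifferentiableAt ℝ f z} :=
    hS.measurableSet.imp (measurableSet_of_differentiableAt ℝ f)
  refine (ae_ae_add_linearMap_mem_iff (LinearMap.toSpanSingleton ℝ X v) volume μ hmeas).2 ?_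
  filter_upwards [hf.ae_differentiableWithinAt_of_mem] with z hz hzS
  exact (hz hzS).differentiableAt (hS.mem_nhds hzS)

/- The segment from `a` to `b` may miss the points of differentiability, but by Fubini almost every
parallel segment meets them almost everywhere. -/
theorem sub_mem_of_fderiv_apply_mem (hf : LipschitzOnWith K f S) (hS : IsOpen S)
    (hS' : Convex ℝ S) {C : Set G} (hC : Convex ℝ C) (hC' : IsClosed C) {a b : X} (ha : a ∈ S)
    (hb : b ∈ S) (hd : ∀ z ∈ S, DifferentiableAt ℝ f z → fderiv ℝ f z (b - a) ∈ C) :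
    f b - f a ∈ C := by
  borelize X
  obtain ⟨v, rfl⟩ : ∃ v, b = a + v := ⟨b - a, (add_sub_cancel a b).symm⟩
  rw [add_sub_cancel_left] at hd
  have hae : ∃ᶠ p in 𝓝 a, ∀ᵐ t : ℝ, p + t • v ∈ S → DifferentiableAt ℝ f (p + t • v) :=
    mem_closure_iff_frequently.1 (MeasureTheory.Measure.dense_of_ae
      (ae_ae_differentiableAt_add_smul MeasureTheory.Measure.addHaar hf hS v) a)
  have htrans : Tendsto (fun p => p + v) (𝓝 a) (𝓝 (a + v)) := (continuous_add_const v).tendsto a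
  have hmem : ∃ᶠ p in 𝓝 a, f (p + v) - f p ∈ C := by
    refine (hae.and_eventually ((hS.eventually_mem ha).and
      (htrans.eventually (hS.eventually_mem hb)))).mono ?_
    rintro p ⟨hp, hpS, hpvS⟩
    have hline : ∀ t ∈ Set.Icc (0 : ℝ) 1, p + t • v ∈ S := fun t ht =>
      hS'.add_smul_mem hpS hpvS ht
    exact sub_mem_of_ae_fderiv_segment_mem hf hC hC' hline (hp.mono fun t ht htI =>
      ⟨ht (hline t htI), hd _ (hline t htI) (ht (hline t htI))⟩)
  have hlim : Tendsto (fun p => f (p + v) - f p) (𝓝 a) (𝓝 (f (a + v) - f a)) :=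
    ((hf.continuousOn.continuousAt (hS.mem_nhds hb)).tendsto.comp htrans).sub
      (hf.continuousOn.continuousAt (hS.mem_nhds ha))
  exact hC'.mem_of_frequently_of_tendsto hmem hlim

end Lipschitz

theorem isCompact_convexHull {V : Type*} [AddCommGroup V] [Module ℝ V] [TopologicalSpace V]
    [IsTopologicalAddGroup V] [ContinuousSMul ℝ V] [FiniteDimensional ℝ V] {s : Set V}
    (hs : IsCompact s) : IsCompact (convexHull ℝ s) := by
  -- By Carathéodory's theorem, finitely many numbers `k` of points suffice.
  have hunion : convexHull ℝ s = ⋃ k ∈ Set.Iic (Module.finrank ℝ V + 1),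
      (fun q : (Fin k → ℝ) × (Fin k → V) => ∑ i, q.1 i • q.2 i) ''
        (stdSimplex ℝ (Fin k) ×ˢ Set.pi Set.univ fun _ => s) := by
    refine Set.Subset.antisymm (fun x hx => ?_) (Set.iUnion₂_subset ?_)
    · obtain ⟨ι, _, z, w, hz, hind, hw, hw1, rfl⟩ := eq_pos_convex_span_of_mem_convexHull hx
      let e := Fintype.equivFin ι
      have hcard : Fintype.card ι ≤ Module.finrank ℝ V + 1 :=
        hind.card_le_finrank_succ.trans (Nat.succ_le_succ (Submodule.finrank_le _))
      exact Set.mem_iUnion₂.2 ⟨_, hcard, (w ∘ e.symm, z ∘ e.symm),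
        ⟨⟨fun i => (hw _).le, (e.symm.sum_comp w).trans hw1⟩, fun i _ => hz ⟨_, rfl⟩⟩,
        e.symm.sum_comp fun i => w i • z i⟩
    · rintro k - _ ⟨⟨w, z⟩, ⟨hw, hz⟩, rfl⟩
      exact (convex_convexHull ℝ s).sum_mem (fun i _ => hw.1 i) hw.2
        fun i _ => subset_convexHull ℝ s (hz i trivial)
  rw [hunion]
  exact (Set.finite_Iic _).isCompact_biUnion fun k _ =>
    ((isCompact_stdSimplex ℝ (Fin k)).prod (isCompact_univ_pi fun _ => hs)).image (by fun_prop)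

section ClarkeJacobian

variable {X G : Type*} [NormedAddCommGroup X] [NormedSpace ℝ X] [NormedAddCommGroup G]
  [NormedSpace ℝ G] {K : NNReal} {f : X → G} {x : X} {s : Set X}

/-- The Bouligand generalized Jacobian (B-subdifferential) of `f` at `x`: the limits of derivatives
of `f` along sequences tending to `x`. Its convex hull is the Clarke generalized Jacobian. -/
def bouligandJacobian (f : X → G) (x : X) : Set (X →L[ℝ] G) :=
  {A | ∃ u : ℕ → X, (∀ k, DifferentiableAt ℝ f (u k)) ∧
    Tendsto u atTop (𝓝 x) ∧ Tendsto (fun k => fderiv ℝ f (u k)) atTop (𝓝 A)}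

theorem bouligandJacobian_subset_clarkeJacobian (f : X → G) (x : X) :
    bouligandJacobian f x ⊆ clarkeJacobian f x :=
  subset_convexHull ℝ _

theorem mem_bouligandJacobian_iff_mem_closure {A : X →L[ℝ] G} :
    A ∈ bouligandJacobian f x ↔
      (x, A) ∈ closure {q | DifferentiableAt ℝ f q.1 ∧ fderiv ℝ f q.1 = q.2} := by
  rw [mem_closure_iff_seq_limit]
  constructor
  · rintro ⟨u, hd, hu, hA⟩
    exact ⟨fun k => (u k, fderiv ℝ f (u k)), fun k => ⟨hd k, rfl⟩, hu.prodMk_nhds hA⟩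
  · rintro ⟨q, hq, hlim⟩
    refine ⟨fun k => (q k).1, fun k => (hq k).1, hlim.fst_nhds, ?_⟩
    simpa only [(hq _).2] using hlim.snd_nhds

theorem isClosed_bouligandJacobian (f : X → G) (x : X) : IsClosed (bouligandJacobian f x) := by
  have hpre : bouligandJacobian f x = Prod.mk x ⁻¹'
      closure {q | DifferentiableAt ℝ f q.1 ∧ fderiv ℝ f q.1 = q.2} :=
    Set.ext fun _ => mem_bouligandJacobian_iff_mem_closure
  rw [hpre]
  exact isClosed_closure.preimage (Continuous.prodMk_right x)

theorem eventually_norm_fderiv_le (hf : LipschitzOnWith K f s) (hs : s ∈ 𝓝 x) :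
    ∀ᶠ z in 𝓝 x, ‖fderiv ℝ f z‖ ≤ K :=
  (eventually_mem_nhds_iff.2 hs).mono fun _ hz => norm_fderiv_le_of_lipschitzOn ℝ hz hf

variable [FiniteDimensional ℝ X] [FiniteDimensional ℝ G]

theorem isCompact_bouligandJacobian (hf : LipschitzOnWith K f s) (hs : s ∈ 𝓝 x) :
    IsCompact (bouligandJacobian f x) := by
  have : ProperSpace (X →L[ℝ] G) := FiniteDimensional.proper ℝ _
  refine (isCompact_closedBall (0 : X →L[ℝ] G) K).of_isClosed_subset
    (isClosed_bouligandJacobian f x) ?_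
  rintro A ⟨u, -, hu, hA⟩
  exact mem_closedBall_zero_iff.2
    (le_of_tendsto hA.norm (hu.eventually (eventually_norm_fderiv_le hf hs)))

theorem isCompact_clarkeJacobian (hf : LipschitzOnWith K f s) (hs : s ∈ 𝓝 x) :
    IsCompact (clarkeJacobian f x) :=
  isCompact_convexHull (isCompact_bouligandJacobian hf hs)

theorem eventually_fderiv_mem_of_bouligandJacobian_subset (hf : LipschitzOnWith K f s)
    (hs : s ∈ 𝓝 x) {U : Set (X →L[ℝ] G)} (hU : IsOpen U) (hsub : bouligandJacobian f x ⊆ U) :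
    ∀ᶠ z in 𝓝 x, DifferentiableAt ℝ f z → fderiv ℝ f z ∈ U := by
  have : ProperSpace (X →L[ℝ] G) := FiniteDimensional.proper ℝ _
  by_contra hcon
  rw [not_eventually] at hcon
  obtain ⟨u, hu, hbad⟩ := exists_seq_forall_of_frequently hcon
  push Not at hbad
  have hbdd : ∀ᶠ k in atTop, fderiv ℝ f (u k) ∈ Metric.closedBall 0 (K : ℝ) :=
    (hu.eventually (eventually_norm_fderiv_le hf hs)).mono fun _ => mem_closedBall_zero_iff.2
  obtain ⟨A, -, φ, hφ, hA⟩ :=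
    (isCompact_closedBall (0 : X →L[ℝ] G) K).tendsto_subseq' hbdd.frequently
  have hAU : A ∈ U := hsub ⟨u ∘ φ, fun k => (hbad _).1, hu.comp hφ.tendsto_atTop, hA⟩
  obtain ⟨k, hk⟩ := (hA.eventually (hU.mem_nhds hAU)).exists
  exact (hbad (φ k)).2 hk

end ClarkeJacobian

/-- `T` is a set of slopes of `f` at `x`: near `x`, every increment of `f` is the image of the
increment of the variable under some member of `T`. This is a set-valued strict derivative, and it
replaces the mean value theorem for maps that are merely locally Lipschitz. -/
def HasSlopeSetAt {X G : Type*} [NormedAddCommGroup X] [NormedSpace ℝ X] [NormedAddCommGroup G]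
    [NormedSpace ℝ G] (f : X → G) (T : Set (X →L[ℝ] G)) (x : X) : Prop :=
  ∀ᶠ p : X × X in 𝓝 (x, x), ∃ A ∈ T, f p.1 - f p.2 = A (p.1 - p.2)

theorem hasSlopeSetAt_cthickening_clarkeJacobian {X G : Type*} [NormedAddCommGroup X]
    [NormedSpace ℝ X] [FiniteDimensional ℝ X] [NormedAddCommGroup G] [NormedSpace ℝ G]
    [FiniteDimensional ℝ G] {K : NNReal} {f : X → G} {x : X} {s : Set X}
    (hf : LipschitzOnWith K f s) (hs : s ∈ 𝓝 x) {ε : ℝ} (hε : 0 < ε) :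
    HasSlopeSetAt f (Metric.cthickening ε (clarkeJacobian f x)) x := by
  have : ProperSpace (X →L[ℝ] G) := FiniteDimensional.proper ℝ _
  have hfderiv := eventually_fderiv_mem_of_bouligandJacobian_subset hf hs Metric.isOpen_thickening
    ((bouligandJacobian_subset_clarkeJacobian f x).trans (Metric.self_subset_thickening hε _))
  obtain ⟨r, hr, hball⟩ := Metric.eventually_nhds_iff_ball.1 (hfderiv.and hs)
  filter_upwards [prod_mem_nhds (Metric.ball_mem_nhds x hr) (Metric.ball_mem_nhds x hr)]
  rintro ⟨b, a⟩ ⟨hb, ha⟩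
  let C : Set G := (fun A : X →L[ℝ] G => A (b - a)) '' Metric.cthickening ε (clarkeJacobian f x)
  have hC : Convex ℝ C := ((convex_convexHull ℝ _).cthickening ε).is_linear_image
    ⟨fun _ _ => rfl, fun _ _ => rfl⟩
  have hC' : IsCompact C := (isCompact_clarkeJacobian hf hs).cthickening.image (by fun_prop)
  obtain ⟨A, hA, heq⟩ : f b - f a ∈ C :=
    sub_mem_of_fderiv_apply_mem (hf.mono fun z hz => (hball z hz).2) Metric.isOpen_ball
      (convex_ball x r) hC hC'.isClosed ha hb fun z hz hd =>
        ⟨_, Metric.thickening_subset_cthickening _ _ ((hball z hz).1 hd), rfl⟩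
  exact ⟨A, hA, heq.symm⟩

section Compactness

variable {E G : Type*} [NormedAddCommGroup E] [NormedSpace ℝ E] [FiniteDimensional ℝ E]
  [NormedAddCommGroup G] [NormedSpace ℝ G]

theorem exists_pos_forall_mul_norm_le_norm_apply {T : Set (E →L[ℝ] G)} (hT : IsCompact T)
    (hinj : ∀ A ∈ T, Function.Injective A) : ∃ c > 0, ∀ A ∈ T, ∀ v, c * ‖v‖ ≤ ‖A v‖ := by
  have : ProperSpace E := FiniteDimensional.proper ℝ E
  have hpos : ∀ q ∈ T ×ˢ Metric.sphere (0 : E) 1, 0 < ‖q.1 q.2‖ := by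
    rintro ⟨A, v⟩ ⟨hA, hv⟩
    exact norm_pos_iff.2 <| (map_ne_zero_iff A (hinj A hA)).2 <|
      ne_zero_of_mem_unit_sphere ⟨v, hv⟩
  obtain ⟨c, hc, hle⟩ := (hT.prod (isCompact_sphere (0 : E) 1)).exists_forall_le'
    (by fun_prop : ContinuousOn (fun q : (E →L[ℝ] G) × E => ‖q.1 q.2‖) _) hpos
  refine ⟨c, hc, fun A hA v => ?_⟩
  rcases eq_or_ne v 0 with rfl | hv
  · simp
  have hunit := hle (A, ‖v‖⁻¹ • v) ⟨hA, by simp [norm_smul, hv]⟩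
  simp only [map_smul, norm_smul, norm_inv, norm_norm] at hunit
  rwa [inv_mul_eq_div, le_div_iff₀ (norm_pos_iff.2 hv)] at hunit

theorem exists_forall_apply_pos {C : Set (StrongDual ℝ E)} (hC : Convex ℝ C) (hC' : IsClosed C)
    (h0 : 0 ∉ C) : ∃ w, ∀ l ∈ C, 0 < l w := by
  obtain ⟨Λ, u, hu0, hu⟩ := geometric_hahn_banach_point_closed hC hC' h0
  rw [map_zero] at hu0
  let Λ' : Module.Dual ℝ (Module.Dual ℝ E) :=
    Λ.toLinearMap ∘ₗ LinearMap.toContinuousLinearMap.toLinearMap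
  refine ⟨(Module.evalEquiv ℝ E).symm Λ', fun l hl => hu0.trans ((hu l hl).trans_eq ?_)⟩
  exact (Module.apply_evalEquiv_symm_apply (R := ℝ) (M := E) l.toLinearMap Λ').symm

theorem isOpen_setOf_bijective : IsOpen {A : E →L[ℝ] G | Function.Bijective A} := by
  have : CompleteSpace E := FiniteDimensional.complete ℝ E
  convert ContinuousLinearEquiv.isOpen (𝕜 := ℝ) (E := E) (F := G)
  ext A
  refine ⟨fun hA => ⟨(LinearEquiv.ofBijective A.toLinearMap hA).toContinuousLinearEquiv, ?_⟩, ?_⟩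
  · ext v
    rfl
  · rintro ⟨e, rfl⟩
    exact e.bijective

end Compactness

theorem exists_forall_inner_apply_pos {X G : Type*} [NormedAddCommGroup X] [NormedSpace ℝ X]
    [FiniteDimensional ℝ X] [NormedAddCommGroup G] [InnerProductSpace ℝ G] {T : Set (X →L[ℝ] G)}
    (hT : IsCompact T) (hT' : Convex ℝ T) (hsurj : ∀ A ∈ T, Function.Surjective A) {r : G}
    (hr : r ≠ 0) : ∃ w, ∀ A ∈ T, 0 < inner ℝ r (A w) := by
  let C : Set (StrongDual ℝ X) := (fun A => (innerSL ℝ r).comp A) '' T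
  have hC : Convex ℝ C := hT'.is_linear_image ⟨by simp, by simp⟩
  have hC' : IsCompact C := hT.image (by fun_prop)
  have h0 : 0 ∉ C := by
    rintro ⟨A, hA, hzero⟩
    obtain ⟨v, hv⟩ := hsurj A hA r
    have hrr : inner ℝ r (A v) = 0 := DFunLike.congr_fun hzero v
    rw [hv] at hrr
    exact hr (inner_self_eq_zero.1 hrr)
  obtain ⟨w, hw⟩ := exists_forall_apply_pos hC hC'.isClosed h0
  exact ⟨w, fun A hA => hw _ ⟨A, hA, rfl⟩⟩

theorem norm_sub_smul_lt_norm {G : Type*} [NormedAddCommGroup G] [InnerProductSpace ℝ G] {r a : G}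
    {t : ℝ} (ht : 0 < t) (hta : t * ‖a‖ ^ 2 < 2 * inner ℝ r a) : ‖r - t • a‖ < ‖r‖ := by
  refine lt_of_pow_lt_pow_left₀ 2 (norm_nonneg r) ?_
  have hexpand : ‖r - t • a‖ ^ 2 = ‖r‖ ^ 2 - t * (2 * inner ℝ r a - t * ‖a‖ ^ 2) := by
    rw [norm_sub_sq_real, real_inner_smul_right, norm_smul, mul_pow, Real.norm_eq_abs, sq_abs]
    ring
  rw [hexpand]
  exact sub_lt_self _ (mul_pos ht (sub_pos.2 hta))

namespace HasSlopeSetAt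

section Operations

variable {X H G W : Type*} [NormedAddCommGroup X] [NormedSpace ℝ X] [NormedAddCommGroup H]
  [NormedSpace ℝ H] [NormedAddCommGroup G] [NormedSpace ℝ G] [NormedAddCommGroup W]
  [NormedSpace ℝ W]

theorem eventually_nhds {f : X → G} {T : Set (X →L[ℝ] G)} {x : X} (h : HasSlopeSetAt f T x) :
    ∀ᶠ z in 𝓝 x, HasSlopeSetAt f T z :=
  ((continuous_id.prodMk continuous_id).tendsto x).eventually (eventually_eventually_nhds.2 h)

theorem continuousAt {f : X → G} {T : Set (X →L[ℝ] G)} {x : X} (h : HasSlopeSetAt f T x)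
    (hT : IsCompact T) : ContinuousAt f x := by
  obtain ⟨C, hC⟩ := hT.exists_bound_of_continuousOn continuousOn_id
  have hbound : ∀ᶠ z in 𝓝 x, ‖f z - f x‖ ≤ C * ‖z - x‖ := by
    filter_upwards [((Continuous.prodMk_left x).tendsto x).eventually h] with z ⟨A, hA, heq⟩
    exact heq ▸ A.le_of_opNorm_le (hC A hA) _
  have hzero : Tendsto (fun z => C * ‖z - x‖) (𝓝 x) (𝓝 0) :=
    Continuous.tendsto' (by fun_prop) _ _ (by simp)
  exact tendsto_iff_norm_sub_tendsto_zero.2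
    (squeeze_zero' (Eventually.of_forall fun _ => norm_nonneg _) hbound hzero)

theorem clm_comp {f : X → G} {T : Set (X →L[ℝ] G)} {x : X} (h : HasSlopeSetAt f T x)
    (L : G →L[ℝ] W) : HasSlopeSetAt (L ∘ f) ((fun A => L.comp A) '' T) x :=
  h.mono fun _ ⟨A, hA, heq⟩ =>
    ⟨L.comp A, ⟨A, hA, rfl⟩, (map_sub L _ _).symm.trans (congrArg L heq)⟩

theorem comp_prodMk_left {F : X × H → G} {T : Set (X × H →L[ℝ] G)} {x : X} {y : H}
    (h : HasSlopeSetAt F T (x, y)) :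
    HasSlopeSetAt (fun z => F (z, y)) ((fun B => B.comp (.inl ℝ X H)) '' T) x := by
  have hslice : Tendsto (fun p : X × X => ((p.1, y), (p.2, y))) (𝓝 (x, x))
      (𝓝 ((x, y), (x, y))) := Continuous.tendsto' (by fun_prop) _ _ rfl
  filter_upwards [hslice.eventually h] with p ⟨B, hB, heq⟩
  exact ⟨B.comp (.inl ℝ X H), ⟨B, hB, rfl⟩, by simpa using heq⟩

theorem prodMk_snd {F : X × H → G} {T : Set (X × H →L[ℝ] G)} {q : X × H}
    (h : HasSlopeSetAt F T q) :
    HasSlopeSetAt (fun p => (F p, p.2)) ((fun B => B.prod (.snd ℝ X H)) '' T) q :=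
  h.mono fun _ ⟨B, hB, heq⟩ => ⟨B.prod (.snd ℝ X H), ⟨B, hB, rfl⟩, Prod.ext heq rfl⟩

end Operations

variable {X G : Type*} [NormedAddCommGroup X] [NormedSpace ℝ X] [FiniteDimensional ℝ X]
  [NormedAddCommGroup G] {f : X → G} {x : X}

theorem exists_pos_mul_norm_sub_le [NormedSpace ℝ G] {T : Set (X →L[ℝ] G)}
    (h : HasSlopeSetAt f T x) (hT : IsCompact T) (hinj : ∀ A ∈ T, Function.Injective A) :
    ∃ c > 0, ∀ᶠ p in 𝓝 (x, x), c * ‖p.1 - p.2‖ ≤ ‖f p.1 - f p.2‖ := by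
  obtain ⟨c, hc, hle⟩ := exists_pos_forall_mul_norm_le_norm_apply hT hinj
  exact ⟨c, hc, h.mono fun p ⟨A, hA, heq⟩ => heq ▸ hle A hA _⟩

theorem eq_of_isLocalMin_norm_sub [InnerProductSpace ℝ G] {T : Set (X →L[ℝ] G)}
    (h : HasSlopeSetAt f T x) (hT : IsCompact T) (hT' : Convex ℝ T)
    (hsurj : ∀ A ∈ T, Function.Surjective A) {q : G}
    (hmin : IsLocalMin (fun z => ‖f z - q‖) x) : f x = q := by
  by_contra hne
  let r := f x - q
  obtain ⟨w, hw⟩ := exists_forall_inner_apply_pos hT hT' hsurj (sub_ne_zero.2 hne : r ≠ 0)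
  obtain ⟨δ, hδ, hδle⟩ := hT.exists_forall_le' (f := fun A => inner ℝ r (A w))
    (by fun_prop) hw
  obtain ⟨M, hM⟩ := hT.exists_bound_of_continuousOn (f := fun A => A w) (by fun_prop)
  have hpath : Tendsto (fun t : ℝ => x - t • w) (𝓝[>] 0) (𝓝 x) :=
    (Continuous.tendsto' (by fun_prop) _ _ (by simp)).mono_left nhdsWithin_le_nhds
  have hsmall : Tendsto (fun t : ℝ => t * M ^ 2) (𝓝[>] 0) (𝓝 0) :=
    (Continuous.tendsto' (by fun_prop) _ _ (by simp)).mono_left nhdsWithin_le_nhds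
  obtain ⟨t, ⟨A, hA, heq⟩, hmin_t, htM, ht⟩ :=
    (((tendsto_const_nhds.prodMk_nhds hpath).eventually h).and ((hpath.eventually hmin).and
      ((hsmall.eventually_lt_const hδ).and self_mem_nhdsWithin))).exists
  have hstep : f (x - t • w) - q = r - t • A w := by
    rw [sub_sub_cancel, map_smul] at heq
    rw [← heq, sub_sub_sub_cancel_left]
  have hmin_r : ‖r‖ ≤ ‖r - t • A w‖ := hstep ▸ (hmin_t : ‖r‖ ≤ ‖f (x - t • w) - q‖)
  refine (norm_sub_smul_lt_norm ht ?_).not_ge hmin_r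
  calc t * ‖A w‖ ^ 2 ≤ t * M ^ 2 := by
        have := ht.le
        gcongr
        exact hM A hA
    _ < δ := htM
    _ ≤ inner ℝ r (A w) := hδle A hA
    _ < 2 * inner ℝ r (A w) := by linarith [hδle A hA]

theorem nhds_le_map_of_innerProductSpace [InnerProductSpace ℝ G] {T : Set (X →L[ℝ] G)}
    (h : HasSlopeSetAt f T x) (hT : IsCompact T) (hT' : Convex ℝ T) (hrank : IsOfMaximalRank T) :
    𝓝 (f x) ≤ map f (𝓝 x) := by
  have : ProperSpace X := FiniteDimensional.proper ℝ X
  intro s hs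
  obtain ⟨c, hc, hlower⟩ := h.exists_pos_mul_norm_sub_le hT fun A hA => (hrank A hA).1
  have hnear := (((Continuous.prodMk_left x).tendsto x).eventually hlower).and
    (h.eventually_nhds.and hs)
  obtain ⟨ρ, hρ, hball⟩ := Metric.nhds_basis_closedBall.eventually_iff.1 hnear
  refine mem_of_superset (Metric.ball_mem_nhds (f x) (half_pos (mul_pos hc hρ))) fun q hq => ?_
  rw [Metric.mem_ball, dist_comm, dist_eq_norm] at hq
  have hcont : ContinuousOn (fun z => ‖f z - q‖) (Metric.closedBall x ρ) := fun z hz =>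
    (((hball hz).2.1.continuousAt hT).sub continuousAt_const).norm.continuousWithinAt
  have hsphere : ∀ z ∈ Metric.sphere x ρ, ‖f x - q‖ < ‖f z - q‖ := fun z hz => by
    have hfar : c * ‖z - x‖ ≤ ‖f z - f x‖ := (hball (Metric.sphere_subset_closedBall hz)).1
    rw [mem_sphere_iff_norm.1 hz] at hfar
    have htri := norm_sub_le_norm_sub_add_norm_sub (f z) q (f x)
    rw [norm_sub_rev q] at htri
    linarith
  obtain ⟨z, hz, hmin⟩ := Metric.exists_isLocalMin_mem_ball hcont
    (Metric.mem_closedBall_self hρ.le) hsphere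
  obtain ⟨-, hslope, hzs⟩ := hball (Metric.ball_subset_closedBall hz)
  exact hslope.eq_of_isLocalMin_norm_sub hT hT' (fun A hA => (hrank A hA).2) hmin ▸ hzs

theorem nhds_le_map [NormedSpace ℝ G] [FiniteDimensional ℝ G] {T : Set (X →L[ℝ] G)}
    (h : HasSlopeSetAt f T x) (hT : IsCompact T) (hT' : Convex ℝ T) (hrank : IsOfMaximalRank T) :
    𝓝 (f x) ≤ map f (𝓝 x) := by
  let e := toEuclidean (E := G)
  have hrank' : IsOfMaximalRank ((fun A => e.toContinuousLinearMap.comp A) '' T) := by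
    rintro _ ⟨A, hA, rfl⟩
    exact e.bijective.comp (hrank A hA)
  have hle := (h.clm_comp e.toContinuousLinearMap).nhds_le_map_of_innerProductSpace
    (hT.image (by fun_prop)) (hT'.is_linear_image ⟨by simp, by simp⟩) hrank'
  rw [← map_map] at hle
  exact (map_le_map_iff e.injective).1 ((e.toHomeomorph.map_nhds_eq (f x)).trans_le hle)

end HasSlopeSetAt

/-- `f` has nonsingular slopes at `x`: its increments near `x` are governed by a compact convex set
of nonsingular linear maps. This is the hypothesis of the nonsmooth inverse function theorem. -/
def HasNonsingularSlopesAt {X G : Type*} [NormedAddCommGroup X] [NormedSpace ℝ X]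
    [NormedAddCommGroup G] [NormedSpace ℝ G] (f : X → G) (x : X) : Prop :=
  ∃ T : Set (X →L[ℝ] G), IsCompact T ∧ Convex ℝ T ∧ IsOfMaximalRank T ∧ HasSlopeSetAt f T x

namespace HasNonsingularSlopesAt

variable {X G : Type*} [NormedAddCommGroup X] [NormedSpace ℝ X] [NormedAddCommGroup G]
  [NormedSpace ℝ G] {f : X → G} {x : X}

theorem continuousAt (h : HasNonsingularSlopesAt f x) : ContinuousAt f x :=
  let ⟨_, hT, _, _, hslope⟩ := h
  hslope.continuousAt hT

variable [FiniteDimensional ℝ X]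

theorem exists_pos_mul_norm_sub_le (h : HasNonsingularSlopesAt f x) :
    ∃ c > 0, ∀ᶠ p in 𝓝 (x, x), c * ‖p.1 - p.2‖ ≤ ‖f p.1 - f p.2‖ :=
  let ⟨_, hT, _, hrank, hslope⟩ := h
  hslope.exists_pos_mul_norm_sub_le hT fun A hA => (hrank A hA).1

theorem exists_mem_nhds_injOn (h : HasNonsingularSlopesAt f x) : ∃ s ∈ 𝓝 x, Set.InjOn f s := by
  obtain ⟨c, hc, hlower⟩ := h.exists_pos_mul_norm_sub_le
  rw [nhds_prod_eq, eventually_prod_self_iff'] at hlower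
  obtain ⟨s, hs, hle⟩ := hlower
  refine ⟨s, hs, fun a ha b hb heq => ?_⟩
  have hab := hle a ha b hb
  rw [heq, sub_self, norm_zero] at hab
  exact sub_eq_zero.1 (norm_le_zero_iff.1 (nonpos_of_mul_nonpos_right hab hc))

variable [FiniteDimensional ℝ G]

theorem nhds_le_map (h : HasNonsingularSlopesAt f x) : 𝓝 (f x) ≤ map f (𝓝 x) :=
  let ⟨_, hT, hT', hrank, hslope⟩ := h
  hslope.nhds_le_map hT hT' hrank

theorem isLocalHomeomorph (h : ∀ x, HasNonsingularSlopesAt f x) : IsLocalHomeomorph f := by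
  have hcont : Continuous f := continuous_iff_continuousAt.2 fun x => (h x).continuousAt
  have hopen : IsOpenMap f := .of_nhds_le fun x => (h x).nhds_le_map
  refine isLocalHomeomorph_iff_isOpenEmbedding_restrict.2 fun x => ?_
  obtain ⟨s, hs, hinj⟩ := (h x).exists_mem_nhds_injOn
  obtain ⟨U, hUs, hU, hxU⟩ := mem_nhds_iff.1 hs
  exact ⟨U, hU.mem_nhds hxU, .of_continuous_injective_isOpenMap
    (hcont.comp continuous_subtype_val) (Set.injOn_iff_injective.1 (hinj.mono hUs))
    (hopen.domRestrict hU)⟩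

end HasNonsingularSlopesAt

section Partial

variable {E H G : Type*} [NormedAddCommGroup E] [NormedSpace ℝ E] [NormedAddCommGroup H]
  [NormedSpace ℝ H] [NormedAddCommGroup G] [NormedSpace ℝ G] {F : E × H → G} {x : E} {y : H}

theorem comp_inl_mem_partialClarkeJacobian {B : E × H →L[ℝ] G}
    (hB : B ∈ clarkeJacobian F (x, y)) : B.comp (.inl ℝ E H) ∈ partialClarkeJacobian F x y :=
  ⟨B.comp (.inr ℝ E H), by rwa [ContinuousLinearMap.coprod_comp_inl_inr]⟩

theorem bijective_prod_snd {B : E × H →L[ℝ] G} (hB : Function.Bijective (B.comp (.inl ℝ E H))) :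
    Function.Bijective (B.prod (.snd ℝ E H)) := by
  have hsplit : ∀ a b, B (a, b) = B.comp (.inl ℝ E H) a + B (0, b) := fun a b => by
    simp [← map_add]
  constructor
  · rintro ⟨a, b⟩ ⟨a', b'⟩ heq
    obtain ⟨hval, rfl : b = b'⟩ := Prod.ext_iff.1 heq
    have hval' : B (a, b) = B (a', b) := hval
    rw [hsplit a, hsplit a', add_left_inj] at hval'
    rw [hB.1 hval']
  · rintro ⟨g, b⟩
    obtain ⟨a, ha⟩ := hB.2 (g - B (0, b))
    exact ⟨(a, b), Prod.ext ((hsplit a b).trans (by rw [ha, sub_add_cancel])) rfl⟩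

variable [FiniteDimensional ℝ E] [FiniteDimensional ℝ H] [FiniteDimensional ℝ G] {K : NNReal}
  {s : Set (E × H)}

theorem exists_hasSlopeSetAt_bijective_comp_inl (hF : LipschitzOnWith K F s) (hs : s ∈ 𝓝 (x, y))
    (hrank : IsOfMaximalRank (partialClarkeJacobian F x y)) :
    ∃ T, IsCompact T ∧ Convex ℝ T ∧ (∀ B ∈ T, Function.Bijective (B.comp (.inl ℝ E H))) ∧
      HasSlopeSetAt F T (x, y) := by
  have : ProperSpace (E × H →L[ℝ] G) := FiniteDimensional.proper ℝ _
  have hcomp : Continuous fun B : E × H →L[ℝ] G => B.comp (.inl ℝ E H) := by fun_prop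
  obtain ⟨δ, hδ, hsub⟩ := (isCompact_clarkeJacobian hF hs).exists_cthickening_subset_open
    (isOpen_setOf_bijective.preimage hcomp)
    fun B hB => hrank _ (comp_inl_mem_partialClarkeJacobian hB)
  exact ⟨_, (isCompact_clarkeJacobian hF hs).cthickening, (convex_convexHull ℝ _).cthickening δ,
    fun B hB => hsub hB, hasSlopeSetAt_cthickening_clarkeJacobian hF hs hδ⟩

theorem hasNonsingularSlopesAt_slice (hF : LipschitzOnWith K F s) (hs : s ∈ 𝓝 (x, y))
    (hrank : IsOfMaximalRank (partialClarkeJacobian F x y)) :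
    HasNonsingularSlopesAt (fun z => F (z, y)) x := by
  obtain ⟨T, hT, hT', hbij, hslope⟩ := exists_hasSlopeSetAt_bijective_comp_inl hF hs hrank
  exact ⟨_, hT.image (by fun_prop), hT'.is_linear_image ⟨by simp, by simp⟩,
    Set.forall_mem_image.2 hbij, hslope.comp_prodMk_left⟩

theorem hasNonsingularSlopesAt_prodMk_snd (hF : LipschitzOnWith K F s) (hs : s ∈ 𝓝 (x, y))
    (hrank : IsOfMaximalRank (partialClarkeJacobian F x y)) :
    HasNonsingularSlopesAt (fun p => (F p, p.2)) (x, y) := by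
  obtain ⟨T, hT, hT', hbij, hslope⟩ := exists_hasSlopeSetAt_bijective_comp_inl hF hs hrank
  have himage : (fun B => B.prod (.snd ℝ E H)) '' T =
      ContinuousLinearMap.prodₗᵢ ℝ '' (T ×ˢ {.snd ℝ E H}) := by
    rw [Set.prod_singleton, Set.image_image]
    rfl
  refine ⟨_, ?_, ?_, Set.forall_mem_image.2 fun B hB => bijective_prod_snd (hbij B hB),
    hslope.prodMk_snd⟩
  · exact himage ▸ (hT.prod isCompact_singleton).image (LinearIsometryEquiv.continuous _)
  · exact himage ▸ (hT'.prod (convex_singleton _)).linear_image _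

end Partial

theorem exists_lipschitzOnWith_of_hasNonsingularSlopesAt {E H G : Type*} [NormedAddCommGroup E]
    [NormedSpace ℝ E] [FiniteDimensional ℝ E] [NormedAddCommGroup H] [NormedSpace ℝ H]
    [FiniteDimensional ℝ H] [NormedAddCommGroup G] [NormedSpace ℝ G] [FiniteDimensional ℝ G]
    {F : E × H → G} {f : H → E} {q : G} (hf : ∀ x y, F (x, y) = q ↔ x = f y) {y : H}
    (h : HasNonsingularSlopesAt (fun p => (F p, p.2)) (f y, y)) :
    ∃ K, ∃ s ∈ 𝓝 y, LipschitzOnWith K f s := by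
  have hgraph : Tendsto (fun z => (f z, z)) (𝓝 y) (𝓝 (f y, y)) := fun U hU => by
    have himage := h.nhds_le_map (image_mem_map hU)
    rw [(hf _ _).2 rfl] at himage
    refine mem_map.2 (mem_of_superset ((Continuous.prodMk_right q).tendsto y himage) ?_)
    rintro z ⟨⟨a, b⟩, hab, heq⟩
    obtain ⟨hq, rfl⟩ := Prod.ext_iff.1 heq
    rwa [(hf _ _).1 hq] at hab
  obtain ⟨c, hc, hlower⟩ := h.exists_pos_mul_norm_sub_le
  rw [nhds_prod_eq] at hlower
  obtain ⟨s, hs, hle⟩ := eventually_prod_self_iff'.1 ((hgraph.prodMap hgraph).eventually hlower)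
  refine ⟨c⁻¹.toNNReal, s, hs, .of_dist_le_mul fun a ha b hb => ?_⟩
  have hab := hle a ha b hb
  simp only [Prod.map_apply, (hf _ _).2, Prod.mk_sub_mk, sub_self, Prod.norm_mk, norm_zero,
    norm_nonneg, max_eq_right] at hab
  rw [Real.coe_toNNReal _ (inv_pos.2 hc).le, dist_eq_norm, dist_eq_norm, le_inv_mul_iff₀ hc]
  exact (mul_le_mul_of_nonneg_left (le_max_left _ _) hc.le).trans hab

section Hadamard

variable {E X : Type*} [TopologicalSpace E] [ConnectedSpace E] [TopologicalSpace X]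
  [SimplyConnectedSpace X] [LocallyPathConnectedSpace X] {p : E → X}

theorem bijective_of_isCoveringMap (hp : IsCoveringMap p) : Function.Bijective p := by
  obtain ⟨e⟩ : Nonempty E := inferInstance
  obtain ⟨σ, ⟨hσ, hpσ⟩, -⟩ :=
    hp.existsUnique_continuousMap_lifts (ContinuousMap.id X) (p e) e rfl
  have hσp : σ ∘ p = id := hp.eq_of_comp_eq (σ.continuous.comp hp.continuous) continuous_id
    (by rw [← Function.comp_assoc, hpσ]; rfl) e hσ
  exact Function.bijective_iff_has_inverse.2 ⟨σ, congrFun hσp, congrFun hpσ⟩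

theorem bijective_of_isLocalHomeomorph_of_isProperMap [T2Space E]
    (hp : IsLocalHomeomorph p) (hp' : IsProperMap p) : Function.Bijective p := by
  have hfiber : ∀ x, (p ⁻¹' {x}).Finite := fun x =>
    (hp'.isCompact_preimage isCompact_singleton).finite
      (.of_openPartialHomeomorph p subset_rfl fun e _ =>
        let ⟨φ, hφ, hpφ⟩ := hp e
        ⟨φ, hφ, hpφ.symm⟩)
  exact bijective_of_isCoveringMap (isCoveringMap_iff_isCoveringMapOn_univ.2
    (hp'.isClosedMap.isCoveringMapOn_of_isLocalHomeomorphOn (fun x _ => hfiber x)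
      hp.isLocalHomeomorphOn))

end Hadamard

theorem IsCoerciveFunctional.tendsto_cocompact {E G : Type*} [NormedAddCommGroup E] [ProperSpace E]
    [NormedAddCommGroup G] [ProperSpace G] {g : E → G}
    (h : IsCoerciveFunctional fun x => (1 / 2 : ℝ) * ‖g x‖ ^ 2) :
    Tendsto g (cocompact E) (cocompact G) := by
  rw [← Metric.cobounded_eq_cocompact, ← Metric.cobounded_eq_cocompact,
    ← tendsto_norm_atTop_iff_cobounded, ← comap_norm_atTop]
  refine tendsto_atTop.2 fun b => ?_
  filter_upwards [tendsto_atTop.1 h ((1 / 2 : ℝ) * b ^ 2)] with x hx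
  exact le_of_abs_le (abs_le_of_sq_le_sq (by linarith) (norm_nonneg _))

theorem theorem4_general {E H G : Type*} [NormedAddCommGroup E] [NormedSpace ℝ E]
    [FiniteDimensional ℝ E] [NormedAddCommGroup H] [NormedSpace ℝ H] [FiniteDimensional ℝ H]
    [NormedAddCommGroup G] [NormedSpace ℝ G] [FiniteDimensional ℝ G] {F : E × H → G}
    (hF : LocallyLipschitz F)
    (hcoercive : ∀ y, IsCoerciveFunctional fun x => (1 / 2 : ℝ) * ‖F (x, y)‖ ^ 2)
    (hrank : ∀ x y, IsOfMaximalRank (partialClarkeJacobian F x y)) :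
    ∃! f : H → E, LocallyLipschitz f ∧ ∀ x y, F (x, y) = 0 ↔ x = f y := by
  have : ProperSpace E := FiniteDimensional.proper ℝ E
  have : ProperSpace G := FiniteDimensional.proper ℝ G
  have hslice : ∀ y, IsLocalHomeomorph fun x => F (x, y) := fun y =>
    HasNonsingularSlopesAt.isLocalHomeomorph fun x =>
      let ⟨_, _, hs, hLip⟩ := hF (x, y)
      hasNonsingularSlopesAt_slice hLip hs (hrank x y)
  have hproper : ∀ y, IsProperMap fun x => F (x, y) := fun y =>
    isProperMap_iff_tendsto_cocompact.2 ⟨(hslice y).continuous, (hcoercive y).tendsto_cocompact⟩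
  have hbij : ∀ y, Function.Bijective fun x => F (x, y) := fun y =>
    bijective_of_isLocalHomeomorph_of_isProperMap (hslice y) (hproper y)
  choose f hf using fun y => (hbij y).2 0
  have hiff : ∀ x y, F (x, y) = 0 ↔ x = f y := fun x y =>
    ⟨fun hx => (hbij y).1 (hx.trans (hf y).symm), fun hx => hx ▸ hf y⟩
  refine ⟨f, ⟨fun y => ?_, hiff⟩, fun g hg => funext fun y => (hiff _ y).1 ((hg.2 _ y).2 rfl)⟩
  obtain ⟨K, s, hs, hLip⟩ := hF (f y, y)
  exact exists_lipschitzOnWith_of_hasNonsingularSlopesAt hiff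
    (hasNonsingularSlopesAt_prodMk_snd hLip hs (hrank (f y) y))

theorem theorem4 (n m : ℕ)
    (F : EuclideanSpace ℝ (Fin n) × EuclideanSpace ℝ (Fin m) → EuclideanSpace ℝ (Fin n))
    (hF : LocallyLipschitz F)
    (hcoercive : ∀ y : EuclideanSpace ℝ (Fin m),
      IsCoerciveFunctional (fun x : EuclideanSpace ℝ (Fin n) => (1 / 2 : ℝ) * ‖F (x, y)‖ ^ 2))
    (hrank : ∀ (x : EuclideanSpace ℝ (Fin n)) (y : EuclideanSpace ℝ (Fin m)),
      IsOfMaximalRank (partialClarkeJacobian F x y)) :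
    ∃! f : EuclideanSpace ℝ (Fin m) → EuclideanSpace ℝ (Fin n),
      LocallyLipschitz f ∧
        ∀ (x : EuclideanSpace ℝ (Fin n)) (y : EuclideanSpace ℝ (Fin m)),
          F (x, y) = 0 ↔ x = f y :=
  theorem4_general hF hcoercive hrank
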